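/- Let $(\mathsf{\Omega},\mathcal F,P)$ be a probability space, $\mathcal B\subset\mathbb R^p$ compact, $V\subseteq\mathcal B$ open and $\beta_0\in V$. Let $g:\mathbb R^p\to\mathbb R^q$ be continuously differentiable with Jacobian $G(\beta)=\partial g(\beta)/\partial\beta^\top$ of rank $q$ for every $\beta\in V$. Let $Q_n(\beta)=Q_n(\omega,\beta)$, $n\in\mathbb N$, be random objective functions such that (a) almost surely $Q_n\to Q_\infty$ uniformly on $\mathcal B$, where $Q_\infty$ is a deterministic function, continuous on $\mathcal B$, whose unique maximizer on $\mathcal B$ is $\beta_0$; (b) almost surely every $Q_n$ is twice continuously differentiable on $V$, and the Hessians $\partial^2Q_n(\beta)/\partial\beta\,\partial\beta^\top$ converge uniformly on $V$ to a deterministic matrix function $A(\beta)$, and $A:=A(\beta_0)$ is invertible; (c) $\sqrt n\,\partial Q_n(\beta_0)/\partial\beta$ converges in distribution to $\mathsf N_p(0,B)$, where $B$ is positive semidefinite. Put $G=G(\beta_0)$, $S=G(-A)^{-1}G^\top$, $\Omega=GA^{-1}BA^{-1}G^\top$, and assume that $\Omega$ is invertible. Almost surely, for every $n$, let $\widehat\beta_n$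 maximize $Q_n$ over $\mathcal B$, let $\widetilde\beta_n$ maximize $Q_n$ over $\{\beta\in\mathcal B: g(\beta)=0\}$, and let $\widetilde\lambda_n$ be the corresponding Lagrange multiplier: whenever $\widetilde\beta_n\in V$, the pair $(\widetilde\beta_n,\widetilde\lambda_n)$ solves the first order conditions $\partial Q_n(\widetilde\beta_n)/\partial\beta-G(\widetilde\beta_n)^\top\widetilde\lambda_n=0$, $g(\widetilde\beta_n)=0$. Here $\widehat\beta_n$ and $\widetilde\lambda_n$ are random vectors. Define $$BF_1=n\,\widetilde\lambda_n^\top S\,\Omega^{-1}g(\widehat\beta_n),\qquad LM=n\,\widetilde\lambda_n^\top S\,\Omega^{-1}S\,\widetilde\lambda_n .$$ Then, under $H_0:\ g(\beta_0)=0$, the two statistics are asymptotically equivalent with common limit distribution $\chi^2_q$. Precisely: (i) almost surely, $BF_1-LM=o\big(\|\sqrt n\,\widetilde\lambda_n\|^2\big)$ as $n\to\infty$; (ii) $BF_1-LM\to0$ in probability; (iii) $BF_1$ and $LM$ both converge in distribution to $\chi^2_q$ (for $q=0$, the point mass at $0$). -/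

import Mathlib

open MeasureTheory ProbabilityTheory Filter Topology Asymptotics Matrix

noncomputable section

/-- The Jacobian `∂g(β)/∂βᵀ`, a `q × p` matrix. -/
def jacobian {p q : ℕ} (g : EuclideanSpace ℝ (Fin p) → EuclideanSpace ℝ (Fin q))
    (β : EuclideanSpace ℝ (Fin p)) : Matrix (Fin q) (Fin p) ℝ :=
  Matrix.of fun i j => (fderiv ℝ g β (EuclideanSpace.single j 1)) i

/-- The Hessian `∂²f(β)/∂β∂βᵀ`, a `p × p` matrix. -/
def hessian {p : ℕ} (f : EuclideanSpace ℝ (Fin p) → ℝ) (β : EuclideanSpace ℝ (Fin p)) :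
    Matrix (Fin p) (Fin p) ℝ :=
  Matrix.of fun i j =>
    (fderiv ℝ (fderiv ℝ f) β (EuclideanSpace.single i 1)) (EuclideanSpace.single j 1)

/-- `b` is a global maximizer of `f` over the set `K` (and lies in `K`). -/
def IsArgmax {E : Type*} (f : E → ℝ) (K : Set E) (b : E) : Prop :=
  b ∈ K ∧ ∀ x ∈ K, f x ≤ f b

/-- The Lagrangian `L(β, l) = Q(β) - g(β)ᵀ l`. -/
def lagrangian {p q : ℕ} (Q : EuclideanSpace ℝ (Fin p) → ℝ)
    (g : EuclideanSpace ℝ (Fin p) → EuclideanSpace ℝ (Fin q))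
    (β : EuclideanSpace ℝ (Fin p)) (l : EuclideanSpace ℝ (Fin q)) : ℝ :=
  Q β - inner ℝ (g β) l

/-- `(β, l)` solves the first order conditions of the Lagrangian problem:
the derivative of `L(·, l)` at `β` exists and vanishes, and `g(β) = 0`. -/
def SolvesLagrange {p q : ℕ} (Q : EuclideanSpace ℝ (Fin p) → ℝ)
    (g : EuclideanSpace ℝ (Fin p) → EuclideanSpace ℝ (Fin q))
    (β : EuclideanSpace ℝ (Fin p)) (l : EuclideanSpace ℝ (Fin q)) : Prop :=
  HasGradientAt (fun b => lagrangian Q g b l) 0 β ∧ g β = 0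

/-- `S = G (-A)⁻¹ Gᵀ`. -/
def matS {p q : ℕ} (G : Matrix (Fin q) (Fin p) ℝ) (A : Matrix (Fin p) (Fin p) ℝ) :
    Matrix (Fin q) (Fin q) ℝ :=
  G * (-A)⁻¹ * Gᵀ

/-- `Ω = G A⁻¹ B A⁻¹ Gᵀ`. -/
def matOmega {p q : ℕ} (G : Matrix (Fin q) (Fin p) ℝ) (A B : Matrix (Fin p) (Fin p) ℝ) :
    Matrix (Fin q) (Fin q) ℝ :=
  G * A⁻¹ * B * A⁻¹ * Gᵀ

/-- `n lᵀ S W⁻¹ v`, the bilinear form statistic; in the application `W = Ω`,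
`l` is the Lagrange multiplier and `v = g(β̂)`. -/
def statBF {q : ℕ} (n : ℕ) (S W : Matrix (Fin q) (Fin q) ℝ)
    (l v : EuclideanSpace ℝ (Fin q)) : ℝ :=
  (n : ℝ) * (l.ofLp ⬝ᵥ ((S * W⁻¹) *ᵥ v.ofLp))

/-- `n lᵀ S W⁻¹ S l`, the Lagrange multiplier statistic. -/
def statLM {q : ℕ} (n : ℕ) (S W : Matrix (Fin q) (Fin q) ℝ)
    (l : EuclideanSpace ℝ (Fin q)) : ℝ :=
  (n : ℝ) * (l.ofLp ⬝ᵥ ((S * W⁻¹ * S) *ᵥ l.ofLp))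

/-- The chi-square distribution with `q` degrees of freedom: the law of the sum of the squares
of `q` independent standard normal variables. -/
def chiSq (q : ℕ) : Measure ℝ :=
  (Measure.pi fun _ : Fin q => gaussianReal 0 1).map fun x => ∑ i, x i ^ 2

instance isProbabilityMeasure_chiSq (q : ℕ) : IsProbabilityMeasure (chiSq q) :=
  Measure.isProbabilityMeasure_map (Measurable.aemeasurable (by fun_prop))

end

/-! The core is deterministic, along almost every path. Uniform convergence to a criterion with a
unique maximizer forces both estimators to `β₀`; under the null `β₀` is feasible, so this also
covers the constrained one. Let h = β̂ − β̃. The score vanishes at β̂ and is Gᵀλ + o(λ) at β̃, so a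
Taylor expansion gives A h ≈ −Gᵀλ and g(β̂) ≈ G h ≈ Sλ with error o(λ)
(`isLittleO_restriction_sub`). Since BF − LM = n λᵀ S Ω⁻¹ (g(β̂) − Sλ), this is (i).

For the limit law, expand at `β₀`: with s the score there and k = β̃ − β₀, one has Gᵀλ ≈ s + A k and
G k ≈ 0. Applying G A⁻¹ eliminates k and leaves Sλ ≈ −G A⁻¹ s with error o(s)
(`isLittleO_multiplier_add_score`). Hence √n Sλ tends to N(0, Ω), and LM, its quadratic form in Ω⁻¹,
tends to chi-square. As n‖λ‖² converges in distribution, (i) yields (ii), and Slutsky transfers the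
limit to BF. All errors are relative little-o's, so no rate of consistency is needed. -/

/-! ### Deterministic asymptotics: uniform expansions, argmax consistency, linear elimination. -/

section Asymptotic

variable {E F : Type*} [NormedAddCommGroup E] [NormedSpace ℝ E]
  [NormedAddCommGroup F] [NormedSpace ℝ F]

/-- If the derivatives `D n` of `f n` converge uniformly on a neighbourhood of `a` to a function
which is continuous at `a`, then the first order expansions of `f n` near `a` hold uniformly
in `n`. -/
theorem isLittleO_sub_sub_of_tendstoUniformlyOn {f : ℕ → E → F} {D : ℕ → E → E →L[ℝ] F}
    {D' : E → E →L[ℝ] F} {V : Set E} {a : E} (hV : V ∈ 𝓝 a)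
    (hf : ∀ n, ∀ x ∈ V, HasFDerivAt (f n) (D n x) x) (hD : TendstoUniformlyOn D D' atTop V)
    (hD' : ContinuousAt D' a) {x y : ℕ → E} (hx : Tendsto x atTop (𝓝 a))
    (hy : Tendsto y atTop (𝓝 a)) :
    (fun n => f n (x n) - f n (y n) - D' a (x n - y n)) =o[atTop] fun n => x n - y n := by
  refine isLittleO_iff.2 fun ε hε => ?_
  have hclose : ∀ᶠ z in 𝓝 a, z ∈ V ∧ dist (D' z) (D' a) < ε / 2 :=
    (show ∀ᶠ z in 𝓝 a, z ∈ V from hV).and (Metric.tendsto_nhds.1 hD' _ (half_pos hε))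
  obtain ⟨δ, hδ, hball⟩ := Metric.eventually_nhds_iff_ball.1 hclose
  filter_upwards [Metric.tendstoUniformlyOn_iff.1 hD _ (half_pos hε),
    hx.eventually (Metric.ball_mem_nhds a hδ), hy.eventually (Metric.ball_mem_nhds a hδ)]
    with n hn hxn hyn
  -- Mean value inequality on a convex ball, where `D n` is within ε/2 of `D'`, and `D'` within ε/2
  -- of `D' a`.
  refine (convex_ball a δ).norm_image_sub_le_of_norm_hasFDerivWithin_le'
    (fun z hz => (hf n z (hball z hz).1).hasFDerivWithinAt) (fun z hz => ?_) hyn hxn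
  rw [← dist_eq_norm]
  have h1 := hn z (hball z hz).1
  have h2 := (hball z hz).2
  rw [dist_comm] at h1
  linarith [dist_triangle (D n z) (D' z) (D' a)]

/-- Near-maximizers of uniformly convergent functions on a compact set converge to the unique
maximizer of the limit. -/
theorem tendsto_of_isMax_of_tendstoUniformlyOn {X : Type*} [TopologicalSpace X] {K : Set X}
    (hK : IsCompact K) {f : ℕ → X → ℝ} {f' : X → ℝ} {b : X} (hb : b ∈ K)
    (hf : TendstoUniformlyOn f f' atTop K) (hcont : ContinuousOn f' K)
    (hmax : ∀ x ∈ K, x ≠ b → f' x < f' b) {x : ℕ → X} (hxK : ∀ n, x n ∈ K)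
    (hx : ∀ n, f n b ≤ f n (x n)) : Tendsto x atTop (𝓝 b) := by
  refine tendsto_nhds.2 fun U hU hbU => ?_
  obtain hemp | hne := (K \ U).eq_empty_or_nonempty
  · exact Filter.Eventually.of_forall fun n => by
      by_contra h
      exact hemp.subset ⟨hxK n, h⟩
  obtain ⟨m, hm, hmmax⟩ := (hK.diff hU).exists_isMaxOn hne (hcont.mono Set.sdiff_subset)
  have hlt : f' m < f' b := hmax m hm.1 fun h => hm.2 (h ▸ hbU)
  -- An error below half the gap `f' b - f' m` at both `x n` and `b` is incompatible with `x n`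
  -- lying outside `U`.
  filter_upwards [Metric.tendstoUniformlyOn_iff.1 hf _ (half_pos (sub_pos.2 hlt))] with n hn
  by_contra h
  have h1 := abs_lt.1 (hn (x n) (hxK n))
  have h2 := abs_lt.1 (hn b hb)
  have h3 : f' (x n) ≤ f' m := hmmax ⟨hxK n, h⟩
  linarith [hx n, h1.1, h2.2]

variable {ι : Type*} {l : Filter ι} {A Ai : E →L[ℝ] E} {G : E →L[ℝ] F} {Gt : F →L[ℝ] E}

/-- The linear response of a restriction `γ ≈ G h` to a multiplier `lam`, when
`A h ≈ -w` and `w ≈ Gt lam`. -/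
theorem isLittleO_add_comp_of_response (hAi : ∀ x, Ai (A x) = x) {h w : ι → E} {lam γ : ι → F}
    (h1 : (fun n => A (h n) + w n) =o[l] h) (h2 : (fun n => w n - Gt (lam n)) =o[l] lam)
    (h3 : (fun n => γ n - G (h n)) =o[l] h) :
    (fun n => γ n + G (Ai (Gt (lam n)))) =o[l] lam := by
  have e1 : (fun n => Ai (A (h n) + w n)) =o[l] h := (Ai.isBigO_comp _ l).trans_isLittleO h1
  have e2 : (fun n => Ai (w n - Gt (lam n))) =o[l] lam := (Ai.isBigO_comp _ l).trans_isLittleO h2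
  -- Self-bounding: `h + Ai w = o(h)` absorbs the error into `h`, and `Ai w = O(lam)`.
  have hO : h =O[l] lam := by
    refine e1.right_isBigO_sub.trans ?_
    have e3 : (fun n => Ai (Gt (lam n))) =O[l] lam := (Ai ∘L Gt).isBigO_comp _ l
    refine (e2.isBigO.add e3).neg_left.congr_left fun n => ?_
    simp only [map_add, map_sub, hAi]
    abel
  have e4 : (fun n => G (Ai (A (h n) + w n) - Ai (w n - Gt (lam n)))) =o[l] lam :=
    (G.isBigO_comp _ l).trans_isLittleO ((e1.trans_isBigO hO).sub e2)
  refine ((h3.trans_isBigO hO).add e4).congr_left fun n => ?_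
  simp only [map_add, map_sub, hAi]
  abel

/-- The multiplier `lam` is asymptotically a linear function of the score `s`, when
`w ≈ s + A k`, `w ≈ Gt lam` and `G k ≈ 0`. -/
theorem isLittleO_comp_sub_of_score (hAi : ∀ x, Ai (A x) = x) {Si : F →L[ℝ] F}
    (hSi : ∀ y, Si (G (Ai (Gt y))) = y) {k w s : ι → E} {lam : ι → F}
    (h1 : (fun n => w n - s n - A (k n)) =o[l] k) (h2 : (fun n => w n - Gt (lam n)) =o[l] lam)
    (h3 : (fun n => G (k n)) =o[l] k) :
    (fun n => G (Ai (Gt (lam n))) - G (Ai (s n))) =o[l] s := by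
  -- A priori neither `lam` nor `s` dominates the other, so errors are first measured against the
  -- pair.
  set r : ι → F × E := fun n => (lam n, s n)
  have hlam : lam =O[l] r := isBigO_fst_prod
  have hs : s =O[l] r := isBigO_snd_prod
  have e1 : (fun n => Ai (w n - s n - A (k n))) =o[l] k :=
    (Ai.isBigO_comp _ l).trans_isLittleO h1
  have e2 : (fun n => w n - Gt (lam n)) =o[l] r := h2.trans_isBigO hlam
  have hk : k =O[l] r := by
    refine e1.right_isBigO_add.trans ?_
    have e3 : (fun n => Ai (w n - Gt (lam n))) =O[l] r :=
      (Ai.isBigO_comp _ l).trans e2.isBigO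
    have e4 : (fun n => Ai (Gt (lam n))) =O[l] r := ((Ai ∘L Gt).isBigO_comp _ l).trans hlam
    have e5 : (fun n => Ai (s n)) =O[l] r := (Ai.isBigO_comp _ l).trans hs
    refine ((e3.add e4).sub e5).congr_left fun n => ?_
    simp only [map_sub, hAi]
    abel
  have hD : (fun n => G (Ai (Gt (lam n))) - G (Ai (s n))) =o[l] r := by
    have e6 : (fun n => G (Ai (w n - s n - A (k n)))) =o[l] r :=
      (G.isBigO_comp _ l).trans_isLittleO (e1.trans_isBigO hk)
    have e7 : (fun n => G (Ai (w n - Gt (lam n)))) =o[l] r :=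
      ((G ∘L Ai).isBigO_comp _ l).trans_isLittleO e2
    refine ((e6.sub e7).add (h3.trans_isBigO hk)).congr_left fun n => ?_
    simp only [map_sub, hAi]
    abel
  -- The left inverse `Si` gives `lam = Si (G (Ai s)) + o(r)`; absorbing the error leaves `s` as the
  -- only scale.
  have hr : r =O[l] s := by
    have e8 : (fun n => (Si (G (Ai (Gt (lam n))) - G (Ai (s n))), (0 : E))) =o[l] r :=
      ((Si.isBigO_comp _ l).trans_isLittleO hD).prod_left (isLittleO_zero _ _)
    refine e8.right_isBigO_sub.trans ?_
    have e9 : (fun n => (Si (G (Ai (s n))), s n)) =O[l] s :=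
      ((Si ∘L G ∘L Ai).isBigO_comp _ l).prod_left (isBigO_refl _ _)
    refine e9.congr_left fun n => ?_
    simp [r, hSi]
  exact hD.trans_isBigO hr

end Asymptotic

/-! ### Gradients, Hessians and Jacobians in coordinates. -/

section Calculus

variable {p q : ℕ}

theorem gradient_apply_eq_fderiv_single (f : EuclideanSpace ℝ (Fin p) → ℝ)
    (x : EuclideanSpace ℝ (Fin p)) (j : Fin p) :
    gradient f x j = fderiv ℝ f x (EuclideanSpace.single j 1) := by
  rw [← toDual_gradient, InnerProductSpace.toDual_apply_apply, EuclideanSpace.inner_single_right]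
  simp

theorem hessian_transpose {f : EuclideanSpace ℝ (Fin p) → ℝ} {x : EuclideanSpace ℝ (Fin p)}
    (hf : ContDiffAt ℝ 2 f x) : (hessian f x)ᵀ = hessian f x := by
  ext i j
  exact (hf.isSymmSndFDerivAt (by simp)) _ _

theorem hasFDerivAt_gradient {f : EuclideanSpace ℝ (Fin p) → ℝ} {x : EuclideanSpace ℝ (Fin p)}
    (hf : ContDiffAt ℝ 2 f x) :
    HasFDerivAt (gradient f) (toEuclideanCLM (𝕜 := ℝ) (hessian f x)) x := by
  rw [← hasFDerivWithinAt_univ, hasFDerivWithinAt_euclidean]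
  intro j
  rw [hasFDerivWithinAt_univ]
  have hd : HasFDerivAt (fderiv ℝ f) (fderiv ℝ (fderiv ℝ f) x) x :=
    ((hf.fderiv_right (m := 1) (by norm_num)).differentiableAt (by norm_num)).hasFDerivAt
  have hj := hd.clm_apply (hasFDerivAt_const (EuclideanSpace.single j (1 : ℝ)) x)
  simp only [← gradient_apply_eq_fderiv_single] at hj
  convert! hj using 1
  refine ContinuousLinearMap.coe_injective
    ((EuclideanSpace.basisFun (Fin p) ℝ).toBasis.ext fun i => ?_)
  -- The matrix acts through its columns, whereas `hessian` differentiates first along its row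
  -- index; symmetry reconciles them.
  have := congrFun (congrFun (hessian_transpose hf) j) i
  simp [hessian, ofLp_toEuclideanCLM] at this ⊢
  exact this.symm

theorem continuousOn_hessian {f : EuclideanSpace ℝ (Fin p) → ℝ}
    {V : Set (EuclideanSpace ℝ (Fin p))} (hV : IsOpen V) (hf : ContDiffOn ℝ 2 f V) :
    ContinuousOn (hessian f) V := by
  have h1 : ContDiffOn ℝ 1 (fderiv ℝ f) V := hf.fderiv_of_isOpen hV (by norm_num)
  have h2 : ContinuousOn (fderiv ℝ (fderiv ℝ f)) V :=
    h1.continuousOn_fderiv_of_isOpen hV le_rfl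
  refine continuousOn_pi.2 fun i => continuousOn_pi.2 fun j => ?_
  exact (h2.clm_apply continuousOn_const).clm_apply continuousOn_const

theorem uniformContinuous_toEuclideanCLM :
    UniformContinuous fun M : Matrix (Fin p) (Fin p) ℝ => toEuclideanCLM (𝕜 := ℝ) M := by
  let T : Matrix (Fin p) (Fin p) ℝ →ₗ[ℝ] _ :=
    (toEuclideanCLM (n := Fin p) (𝕜 := ℝ)).toAlgEquiv.toLinearMap
  exact (LinearMap.toContinuousLinearMap T).uniformContinuous

/-- Second order necessary condition at a local maximum. -/
theorem inner_fderiv_gradient_nonpos {E : Type*} [NormedAddCommGroup E] [InnerProductSpace ℝ E]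
    [CompleteSpace E] {f : E → ℝ} {x : E} {D : E →L[ℝ] E} (hf : ∀ᶠ y in 𝓝 x, DifferentiableAt ℝ f y)
    (hD : HasFDerivAt (gradient f) D x) (hmax : IsLocalMax f x) (v : E) : inner ℝ (D v) v ≤ 0 := by
  by_contra! hpos
  let φ : ℝ → ℝ := fun t => f (x + t • v)
  have hline (t : ℝ) : HasDerivAt (fun t : ℝ => x + t • v) v t := by
    simpa using ((hasDerivAt_id t).smul_const v).const_add x
  have htend : Tendsto (fun t : ℝ => x + t • v) (𝓝 0) (𝓝 x) := by
    simpa [ContinuousAt] using (hline 0).continuousAt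
  have hφ : ∀ᶠ t in 𝓝 (0 : ℝ), deriv φ t = inner ℝ (gradient f (x + t • v)) v := by
    filter_upwards [htend.eventually hf] with t ht
    have := ht.hasFDerivAt.comp_hasDerivAt t (hline t)
    rw [← toDual_gradient, InnerProductSpace.toDual_apply_apply] at this
    exact this.deriv
  have hφ2 : deriv (deriv φ) 0 = inner ℝ (D v) v := by
    rw [EventuallyEq.deriv_eq hφ]
    have hD' : HasFDerivAt (gradient f) D (x + (0 : ℝ) • v) := by simpa using hD
    have := (hD'.comp_hasDerivAt (0 : ℝ) (hline 0)).inner ℝ (hasDerivAt_const (0 : ℝ) v)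
    simpa using this.deriv
  have hmaxφ : IsLocalMax φ 0 := by
    have := htend.eventually hmax
    simpa [IsLocalMax, IsMaxFilter, φ] using this
  have hcont : ContinuousAt φ 0 := by
    have h0 : ContinuousAt f (x + (0 : ℝ) • v) := by simpa using hf.self_of_nhds.continuousAt
    exact ContinuousAt.comp (f := fun t : ℝ => x + t • v) h0 (hline 0).continuousAt
  -- A positive second derivative would make 0 a local minimum as well, so `φ` would be locally
  -- constant and its second derivative zero.
  have hmin : IsLocalMin φ 0 :=
    isLocalMin_of_deriv_deriv_pos (by rw [hφ2]; exact hpos) hmaxφ.deriv_eq_zero hcont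
  have hconst : φ =ᶠ[𝓝 0] fun _ => φ 0 := by
    filter_upwards [hmaxφ, hmin] with t h1 h2 using le_antisymm h1 h2
  have hz := hconst.deriv.deriv_eq
  rw [hφ2] at hz
  simp at hz
  exact hpos.ne' hz

theorem jacobian_mulVec (g : EuclideanSpace ℝ (Fin p) → EuclideanSpace ℝ (Fin q))
    (x v : EuclideanSpace ℝ (Fin p)) :
    jacobian g x *ᵥ v.ofLp = (fderiv ℝ g x v).ofLp := by
  ext i
  conv_rhs => rw [← (EuclideanSpace.basisFun (Fin p) ℝ).sum_repr v]
  simp [jacobian, mulVec, dotProduct, mul_comm]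

theorem jacobian_transpose_mulVec (g : EuclideanSpace ℝ (Fin p) → EuclideanSpace ℝ (Fin q))
    (x : EuclideanSpace ℝ (Fin p)) (l : EuclideanSpace ℝ (Fin q)) :
    (jacobian g x)ᵀ *ᵥ l.ofLp = (ContinuousLinearMap.adjoint (fderiv ℝ g x) l).ofLp := by
  ext j
  have : (ContinuousLinearMap.adjoint (fderiv ℝ g x) l).ofLp j =
      inner ℝ (EuclideanSpace.single j (1 : ℝ)) (ContinuousLinearMap.adjoint (fderiv ℝ g x) l) := by
    simp [EuclideanSpace.inner_single_left]
  rw [this, ContinuousLinearMap.adjoint_inner_right, PiLp.inner_apply]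
  simp [jacobian, mulVec, dotProduct, mul_comm]

theorem SolvesLagrange.gradient_eq {Q : EuclideanSpace ℝ (Fin p) → ℝ}
    {g : EuclideanSpace ℝ (Fin p) → EuclideanSpace ℝ (Fin q)} {β : EuclideanSpace ℝ (Fin p)}
    {l : EuclideanSpace ℝ (Fin q)} (h : SolvesLagrange Q g β l) (hQ : DifferentiableAt ℝ Q β)
    (hg : DifferentiableAt ℝ g β) :
    gradient Q β = ContinuousLinearMap.adjoint (fderiv ℝ g β) l := by
  have h1 : HasFDerivAt (fun b => lagrangian Q g b l) _ β :=
    hQ.hasFDerivAt.sub (hg.hasFDerivAt.inner ℝ (hasFDerivAt_const l β))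
  have h2 := h1.unique h.1.hasFDerivAt
  refine ext_inner_right ℝ fun v => ?_
  have h3 := congrArg (fun T => T v) h2
  rw [ContinuousLinearMap.adjoint_inner_left, ← InnerProductSpace.toDual_apply_apply (𝕜 := ℝ),
    toDual_gradient]
  simp at h3
  rw [real_inner_comm]
  linarith

end Calculus

/-! ### Convergence in distribution and Gaussian laws. -/

section Probability

variable {Ω Ω' : Type*} [MeasurableSpace Ω] [MeasurableSpace Ω'] {P : Measure Ω}
  [IsProbabilityMeasure P] {P' : Measure Ω'} [IsProbabilityMeasure P']

/-- Convergence in distribution to zero implies convergence in probability. -/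
theorem TendstoInDistribution.tendstoInMeasure_zero {X : ℕ → Ω → ℝ}
    (h : TendstoInDistribution X atTop (fun _ : Ω' => (0 : ℝ)) (fun _ => P) P') :
    TendstoInMeasure P X atTop fun _ => 0 := by
  rw [tendstoInMeasure_iff_norm]
  intro ε hε
  have hcl : IsClosed {x : ℝ | ε ≤ ‖x‖} := isClosed_le continuous_const continuous_norm
  have hlim := ProbabilityMeasure.limsup_measure_closed_le_of_tendsto h.tendsto hcl
  have hzero : (P'.map fun _ : Ω' => (0 : ℝ)) {x : ℝ | ε ≤ ‖x‖} = 0 := by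
    rw [Measure.map_apply measurable_const hcl.measurableSet]
    simp [not_le.2 hε]
  simp only [ProbabilityMeasure.coe_mk] at hlim
  rw [hzero] at hlim
  refine tendsto_of_le_liminf_of_limsup_le zero_le ?_
  refine le_trans (le_of_eq ?_) hlim
  congr 1
  ext n
  rw [Measure.map_apply_of_aemeasurable (h.forall_aemeasurable n) hcl.measurableSet]
  simp

/-- A sequence of random vectors which is almost surely negligible with respect to a sequence
converging in distribution tends to zero in probability. -/
theorem tendstoInMeasure_zero_of_isLittleO {E F : Type*} [NormedAddCommGroup E] [MeasurableSpace E]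
    [BorelSpace E] [NormedAddCommGroup F] [MeasurableSpace F] [BorelSpace F]
    {X : ℕ → Ω → E} {Y : ℕ → Ω → F} {Z : Ω' → F} (hX : ∀ n, AEMeasurable (X n) P)
    (hY : TendstoInDistribution Y atTop Z (fun _ => P) P')
    (hXY : ∀ᵐ ω ∂P, (fun n => X n ω) =o[atTop] fun n => Y n ω) :
    TendstoInMeasure P X atTop fun _ => 0 := by
  have hYm := hY.forall_aemeasurable
  -- Slutsky for the product of this ratio, which tends to 0, with `‖Y‖`, which converges in
  -- distribution.
  have hquot : TendstoInMeasure P (fun n ω => ‖X n ω‖ / ‖Y n ω‖) atTop fun _ => (0 : ℝ) := by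
    refine tendstoInMeasure_of_tendsto_ae
      (fun n => ((hX n).norm.div (hYm n).norm).aestronglyMeasurable) ?_
    filter_upwards [hXY] with ω hω
    exact hω.norm_norm.tendsto_div_nhds_zero
  have hprod := (hY.continuous_comp continuous_norm).continuous_comp_prodMk_of_tendstoInMeasure_const
    (g := fun z : ℝ × ℝ => z.2 * z.1) (by fun_prop) hquot
    (fun n => (hX n).norm.div (hYm n).norm)
  simp only [zero_mul] at hprod
  have hsub : TendstoInMeasure P ((fun n ω => ‖X n ω‖) -
      fun n ω => ‖X n ω‖ / ‖Y n ω‖ * ‖Y n ω‖) atTop 0 := by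
    refine tendstoInMeasure_of_tendsto_ae (fun n => ((hX n).norm.sub
      (((hX n).norm.div (hYm n).norm).mul (hYm n).norm)).aestronglyMeasurable) ?_
    filter_upwards [hXY] with ω hω
    refine tendsto_const_nhds.congr' ?_
    filter_upwards [hω.isBigO.eq_zero_imp] with n hn
    -- Division by zero yields 0 here; the little-o relation makes `X n ω` vanish too for large `n`.
    by_cases hy : Y n ω = 0
    · simp [hy, hn hy]
    · simp [div_mul_cancel₀ _ (norm_ne_zero_iff.2 hy)]
  have hnorm := tendstoInDistribution_of_tendstoInMeasure_sub (fun n ω => ‖X n ω‖) _ hprod hsub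
    fun n => (hX n).norm
  have := TendstoInDistribution.tendstoInMeasure_zero hnorm
  rw [tendstoInMeasure_iff_norm] at this ⊢
  simpa using this

/-- Convergence in distribution sees only the law of the limit, so a transformed Gaussian variable
may be replaced by `id` under the image law. -/
theorem TendstoInDistribution.of_map_eq {E Ω'' : Type*} [TopologicalSpace E] [MeasurableSpace E]
    [OpensMeasurableSpace E] [MeasurableSpace Ω''] {P'' : Measure Ω''} [IsProbabilityMeasure P'']
    {X : ℕ → Ω → E} {Z : Ω' → E} {Z' : Ω'' → E}
    (h : TendstoInDistribution X atTop Z (fun _ => P) P') (hZ' : AEMeasurable Z' P'')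
    (hmap : P'.map Z = P''.map Z') : TendstoInDistribution X atTop Z' (fun _ => P) P'' where
  forall_aemeasurable := h.forall_aemeasurable
  aemeasurable_limit := hZ'
  tendsto := by
    have := h.tendsto
    simp only [hmap] at this
    exact this

/-- The image of a centred normal law under a linear map. -/
theorem map_multivariateGaussian_zero {p q : ℕ} {B : Matrix (Fin p) (Fin p) ℝ} (hB : B.PosSemidef)
    (T : EuclideanSpace ℝ (Fin p) →L[ℝ] EuclideanSpace ℝ (Fin q)) (M : Matrix (Fin q) (Fin p) ℝ)
    (hT : ∀ x, (ContinuousLinearMap.adjoint T x).ofLp = Mᵀ *ᵥ x.ofLp) :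
    (multivariateGaussian 0 B).map T = multivariateGaussian 0 (M * B * Mᵀ) := by
  have hpsd : (M * B * Mᵀ).PosSemidef := by
    simpa using hB.mul_mul_conjTranspose_same M
  refine Measure.ext_of_charFun ?_
  ext t
  have : charFun ((multivariateGaussian 0 B).map T) t =
      charFun (multivariateGaussian 0 B) (ContinuousLinearMap.adjoint T t) := by
    rw [charFun_apply, charFun_apply, integral_map (by fun_prop) (by fun_prop)]
    simp_rw [ContinuousLinearMap.adjoint_inner_right]
  rw [this, charFun_multivariateGaussian hB, charFun_multivariateGaussian hpsd, hT]
  congr 3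
  · simp
  · rw [← mulVec_mulVec, ← mulVec_mulVec, dotProduct_mulVec t.ofLp, ← mulVec_transpose]

/-- The standardized square norm of a nondegenerate centred normal vector is chi-square. -/
theorem map_quadratic_multivariateGaussian {q : ℕ} {W : Matrix (Fin q) (Fin q) ℝ}
    (hW : W.PosDef) :
    (multivariateGaussian 0 W).map (fun y => y.ofLp ⬝ᵥ (W⁻¹ *ᵥ y.ofLp)) = chiSq q := by
  open scoped MatrixOrder in
  have hsq : CFC.sqrt W * CFC.sqrt W = W := CFC.sqrt_mul_sqrt_self _ hW.posSemidef.nonneg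
  have hsym : (CFC.sqrt W)ᵀ = CFC.sqrt W := by
    open scoped MatrixOrder in
    have : IsSelfAdjoint (CFC.sqrt W) := (CFC.sqrt_nonneg W).isSelfAdjoint
    simpa [IsSelfAdjoint, star_eq_conjTranspose] using this
  have hdet : IsUnit W.det := (isUnit_iff_isUnit_det _).1 hW.isUnit
  have hdet' : IsUnit (CFC.sqrt W).det := by
    rw [← hsq, det_mul] at hdet
    exact isUnit_of_mul_isUnit_left hdet
  -- Writing y = W^{1/2} z with z standard normal reduces the quadratic form to zᵀz.
  have hone : CFC.sqrt W * W⁻¹ * CFC.sqrt W = 1 := by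
    have : W⁻¹ = (CFC.sqrt W)⁻¹ * (CFC.sqrt W)⁻¹ := by rw [← Matrix.mul_inv_rev, hsq]
    rw [this, ← Matrix.mul_assoc, Matrix.mul_nonsing_inv _ hdet', Matrix.one_mul,
      Matrix.nonsing_inv_mul _ hdet']
  have hm : Measurable fun y : EuclideanSpace ℝ (Fin q) => y.ofLp ⬝ᵥ (W⁻¹ *ᵥ y.ofLp) := by
    refine Continuous.measurable ?_
    fun_prop
  rw [multivariateGaussian, ← map_pi_eq_stdGaussian, Measure.map_map hm (by fun_prop),
    Measure.map_map (hm.comp (by fun_prop)) (by fun_prop), chiSq]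
  congr 1
  ext x
  simp only [Function.comp_apply, zero_add, ofLp_toEuclideanCLM]
  rw [mulVec_mulVec, ← vecMul_transpose (CFC.sqrt W), hsym, ← dotProduct_mulVec, mulVec_mulVec,
    ← Matrix.mul_assoc, hone, one_mulVec]
  simp [dotProduct, pow_two]

end Probability

/-! ### The matrix S and the two statistics. -/

section LinearAlgebra

variable {p q : ℕ}

/-- `S = G (-A)⁻¹ Gᵀ` is positive definite when `-A` is and `G` has full row rank. -/
theorem posDef_matS {G : Matrix (Fin q) (Fin p) ℝ} {A : Matrix (Fin p) (Fin p) ℝ}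
    (hA : (-A).PosDef) (hG : G.rank = q) : (matS G A).PosDef := by
  have hli : LinearIndependent ℝ G.row := by
    rw [linearIndependent_iff_card_eq_finrank_span, Set.finrank, ← G.rank_eq_finrank_span_row, hG,
      Fintype.card_fin]
  have := hA.inv.mul_mul_conjTranspose_same (B := G) (Matrix.vecMul_injective_iff.2 hli)
  simpa [matS] using this

theorem toEuclideanCLM_matS (g : EuclideanSpace ℝ (Fin p) → EuclideanSpace ℝ (Fin q))
    (x : EuclideanSpace ℝ (Fin p)) (A : Matrix (Fin p) (Fin p) ℝ) (hA : IsUnit A.det)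
    (l : EuclideanSpace ℝ (Fin q)) :
    toEuclideanCLM (𝕜 := ℝ) (matS (jacobian g x) A) l = -fderiv ℝ g x
      (toEuclideanCLM (𝕜 := ℝ) A⁻¹ (ContinuousLinearMap.adjoint (fderiv ℝ g x) l)) := by
  have hneg : (-A)⁻¹ = -A⁻¹ := by
    refine Matrix.inv_eq_left_inv ?_
    rw [neg_mul_neg, Matrix.nonsing_inv_mul _ hA]
  refine WithLp.ofLp_injective 2 ?_
  rw [ofLp_toEuclideanCLM, WithLp.ofLp_neg, ← jacobian_mulVec, ofLp_toEuclideanCLM,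
    ← jacobian_transpose_mulVec, matS, hneg, mulVec_mulVec, mulVec_mulVec, ← neg_mulVec]
  simp [Matrix.mul_assoc]

/-- Isolates the residual `v - S l`, which the restriction expansion shows to be o(λ). -/
theorem statBF_sub_statLM (n : ℕ) (S W : Matrix (Fin q) (Fin q) ℝ)
    (l v : EuclideanSpace ℝ (Fin q)) :
    statBF n S W l v - statLM n S W l =
      n * inner ℝ l (toEuclideanCLM (𝕜 := ℝ) (S * W⁻¹) (v - toEuclideanCLM (𝕜 := ℝ) S l)) := by
  rw [inner_toEuclideanCLM, statBF, statLM, WithLp.ofLp_sub, ofLp_toEuclideanCLM, mulVec_sub,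
    mulVec_mulVec, dotProduct_sub, mul_sub]

/-- Makes LM a fixed continuous function of √n Sλ, ready for the continuous mapping theorem. -/
theorem statLM_eq (n : ℕ) {S W : Matrix (Fin q) (Fin q) ℝ} (hS : Sᵀ = S)
    (l : EuclideanSpace ℝ (Fin q)) :
    statLM n S W l = (toEuclideanCLM (𝕜 := ℝ) S (√(n : ℝ) • l)).ofLp ⬝ᵥ
      (W⁻¹ *ᵥ (toEuclideanCLM (𝕜 := ℝ) S (√(n : ℝ) • l)).ofLp) := by
  rw [map_smul, WithLp.ofLp_smul, mulVec_smul, smul_dotProduct, dotProduct_smul, smul_smul,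
    Real.mul_self_sqrt (Nat.cast_nonneg n), ofLp_toEuclideanCLM, statLM, smul_eq_mul, mulVec_mulVec,
    ← vecMul_transpose S, hS, ← dotProduct_mulVec, mulVec_mulVec, Matrix.mul_assoc]

end LinearAlgebra

/-! ### Pathwise expansions of score, restriction and multiplier. -/

section Expansion

variable {p q : ℕ} {V : Set (EuclideanSpace ℝ (Fin p))} {β₀ : EuclideanSpace ℝ (Fin p)}
  {Q : ℕ → EuclideanSpace ℝ (Fin p) → ℝ}
  {Alim : EuclideanSpace ℝ (Fin p) → Matrix (Fin p) (Fin p) ℝ}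
  {x y : ℕ → EuclideanSpace ℝ (Fin p)}

theorem continuousOn_limit_hessian (hV : IsOpen V) (hQ : ∀ n, ContDiffOn ℝ 2 (Q n) V)
    (hA : TendstoUniformlyOn (fun n β => hessian (Q n) β) Alim atTop V) : ContinuousOn Alim V :=
  hA.continuousOn (Frequently.of_forall fun n => continuousOn_hessian hV (hQ n))

theorem limit_hessian_transpose (hV : IsOpen V) (hβ₀ : β₀ ∈ V)
    (hQ : ∀ n, ContDiffOn ℝ 2 (Q n) V)
    (hA : TendstoUniformlyOn (fun n β => hessian (Q n) β) Alim atTop V) :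
    (Alim β₀)ᵀ = Alim β₀ := by
  have h := hA.tendsto_at hβ₀
  refine tendsto_nhds_unique ((continuous_id.matrix_transpose.tendsto _).comp h) (h.congr fun n => ?_)
  exact (hessian_transpose ((hQ n).contDiffAt (hV.mem_nhds hβ₀))).symm

/-- First order expansion of the score around the true parameter. -/
theorem isLittleO_gradient_sub (hV : IsOpen V) (hβ₀ : β₀ ∈ V)
    (hQ : ∀ n, ContDiffOn ℝ 2 (Q n) V)
    (hA : TendstoUniformlyOn (fun n β => hessian (Q n) β) Alim atTop V)
    (hx : Tendsto x atTop (𝓝 β₀)) (hy : Tendsto y atTop (𝓝 β₀)) :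
    (fun n => gradient (Q n) (x n) - gradient (Q n) (y n) -
      toEuclideanCLM (𝕜 := ℝ) (Alim β₀) (x n - y n)) =o[atTop] fun n => x n - y n := by
  refine isLittleO_sub_sub_of_tendstoUniformlyOn (V := V)
    (D' := fun β => toEuclideanCLM (𝕜 := ℝ) (Alim β)) (hV.mem_nhds hβ₀)
    (fun n β hβ => hasFDerivAt_gradient ((hQ n).contDiffAt (hV.mem_nhds hβ)))
    (uniformContinuous_toEuclideanCLM.comp_tendstoUniformlyOn hA) ?_ hx hy
  exact uniformContinuous_toEuclideanCLM.continuous.continuousAt.comp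
    ((continuousOn_limit_hessian hV hQ hA).continuousAt (hV.mem_nhds hβ₀))

/-- The limit Hessian at the limit of local maximizers is negative semidefinite. -/
theorem posSemidef_neg_limit_hessian (hV : IsOpen V) (hβ₀ : β₀ ∈ V)
    (hQ : ∀ n, ContDiffOn ℝ 2 (Q n) V)
    (hA : TendstoUniformlyOn (fun n β => hessian (Q n) β) Alim atTop V)
    (hx : Tendsto x atTop (𝓝 β₀)) (hmax : ∀ᶠ n in atTop, IsLocalMax (Q n) (x n)) :
    (-Alim β₀).PosSemidef := by
  have hxV : ∀ᶠ n in atTop, x n ∈ V := hx.eventually (hV.mem_nhds hβ₀)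
  have hlim : Tendsto (fun n => hessian (Q n) (x n)) atTop (𝓝 (Alim β₀)) :=
    hA.tendsto_comp (continuousOn_limit_hessian hV hQ hA β₀ hβ₀)
      (tendsto_nhdsWithin_iff.2 ⟨hx, hxV⟩)
  refine PosSemidef.of_dotProduct_mulVec_nonneg ?_ fun v => ?_
  · have := limit_hessian_transpose hV hβ₀ hQ hA
    simp [IsHermitian, this]
  · have hcont : Continuous fun M : Matrix (Fin p) (Fin p) ℝ =>
        inner ℝ (WithLp.toLp 2 v) (toEuclideanCLM (𝕜 := ℝ) M (WithLp.toLp 2 v)) :=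
      continuous_const.inner (uniformContinuous_toEuclideanCLM.continuous.clm_apply
        continuous_const)
    have hle := le_of_tendsto ((hcont.tendsto _).comp hlim) (b := 0) ?_
    · rw [inner_toEuclideanCLM] at hle
      simpa [neg_mulVec] using hle
    · filter_upwards [hxV, hmax] with n hn hm
      rw [Function.comp_apply, real_inner_comm]
      refine inner_fderiv_gradient_nonpos ?_
        (hasFDerivAt_gradient ((hQ n).contDiffAt (hV.mem_nhds hn))) hm _
      filter_upwards [hV.mem_nhds hn] with z hz
      exact ((hQ n).contDiffAt (hV.mem_nhds hz)).differentiableAt (by norm_num)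

variable {g : EuclideanSpace ℝ (Fin p) → EuclideanSpace ℝ (Fin q)}
  {lam : ℕ → EuclideanSpace ℝ (Fin q)}

/-- The first order condition is exact with the Jacobian at `x n`; moving it to `β₀` costs a
vanishing operator norm times `‖lam n‖`. -/
theorem isLittleO_gradient_sub_adjoint (hV : IsOpen V) (hβ₀ : β₀ ∈ V)
    (hQ : ∀ n, ContDiffOn ℝ 2 (Q n) V) (hg : ContDiff ℝ 1 g) (hx : Tendsto x atTop (𝓝 β₀))
    (hlam : ∀ n, x n ∈ V → SolvesLagrange (Q n) g (x n) (lam n)) :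
    (fun n => gradient (Q n) (x n) - ContinuousLinearMap.adjoint (fderiv ℝ g β₀) (lam n))
      =o[atTop] lam := by
  have hlim : Tendsto (fun n => ContinuousLinearMap.adjoint (fderiv ℝ g (x n)) -
      ContinuousLinearMap.adjoint (fderiv ℝ g β₀)) atTop (𝓝 0) := by
    rw [← sub_self (ContinuousLinearMap.adjoint (fderiv ℝ g β₀))]
    refine Tendsto.sub ?_ tendsto_const_nhds
    exact (ContinuousLinearMap.adjoint.continuous.tendsto _).comp
      (((hg.continuous_fderiv one_ne_zero).tendsto _).comp hx)
  have hsmall := (isLittleO_one_iff ℝ).2 hlim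
  have hmul := hsmall.norm_left.mul_isBigO (isBigO_refl (fun n => ‖lam n‖) atTop)
  refine (IsBigO.of_bound 1 ?_).trans_isLittleO (hmul.trans_isBigO ?_)
  · filter_upwards [hx.eventually (hV.mem_nhds hβ₀)] with n hn
    rw [(hlam n hn).gradient_eq (((hQ n).contDiffAt (hV.mem_nhds hn)).differentiableAt
      (by norm_num)) (hg.differentiable one_ne_zero _), ← _root_.sub_apply]
    refine (ContinuousLinearMap.le_opNorm _ _).trans_eq ?_
    simp
  · simpa using isBigO_refl lam atTop

/-- The restriction at the unconstrained estimator is asymptotically linear in the multiplier. -/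
theorem isLittleO_restriction_sub (hV : IsOpen V) (hβ₀ : β₀ ∈ V)
    (hQ : ∀ n, ContDiffOn ℝ 2 (Q n) V) (hg : ContDiff ℝ 1 g)
    (hA : TendstoUniformlyOn (fun n β => hessian (Q n) β) Alim atTop V)
    (hAinv : IsUnit (Alim β₀).det) (hx : Tendsto x atTop (𝓝 β₀))
    (hmax : ∀ᶠ n in atTop, IsLocalMax (Q n) (x n)) (hy : Tendsto y atTop (𝓝 β₀))
    (hgy : ∀ n, g (y n) = 0) (hlam : ∀ n, y n ∈ V → SolvesLagrange (Q n) g (y n) (lam n)) :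
    (fun n => g (x n) - toEuclideanCLM (𝕜 := ℝ) (matS (jacobian g β₀) (Alim β₀)) (lam n))
      =o[atTop] lam := by
  have hAi (v) : toEuclideanCLM (𝕜 := ℝ) (Alim β₀)⁻¹ (toEuclideanCLM (𝕜 := ℝ) (Alim β₀) v) = v := by
    rw [← mul_apply_eq_comp, ← map_mul, nonsing_inv_mul _ hAinv]
    simp
  have h3 := ((hg.hasStrictFDerivAt one_ne_zero (x := β₀)).isLittleO).comp_tendsto (hx.prodMk_nhds hy)
  simp only [Function.comp_def, hgy, sub_zero] at h3
  refine (isLittleO_add_comp_of_response (w := fun n => gradient (Q n) (y n)) hAi ?_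
    (isLittleO_gradient_sub_adjoint hV hβ₀ hQ hg hy hlam) h3).congr_left fun n => ?_
  -- The score vanishes at the interior maximizer `x n`, so only the score at `y n` and the Hessian
  -- term remain.
  · refine (isLittleO_gradient_sub hV hβ₀ hQ hA hx hy).neg_left.congr' ?_ EventuallyEq.rfl
    filter_upwards [hmax] with n hn
    have : gradient (Q n) (x n) = 0 := by simp [gradient, hn.fderiv_eq_zero]
    rw [this]
    abel
  · rw [toEuclideanCLM_matS _ _ _ hAinv, sub_neg_eq_add]

/-- The multiplier is asymptotically linear in the score at the true parameter. -/
theorem isLittleO_multiplier_add_score (hV : IsOpen V) (hβ₀ : β₀ ∈ V)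
    (hQ : ∀ n, ContDiffOn ℝ 2 (Q n) V) (hg : ContDiff ℝ 1 g) (hgβ₀ : g β₀ = 0)
    (hA : TendstoUniformlyOn (fun n β => hessian (Q n) β) Alim atTop V)
    (hAinv : IsUnit (Alim β₀).det) (hS : IsUnit (matS (jacobian g β₀) (Alim β₀)).det)
    (hy : Tendsto y atTop (𝓝 β₀)) (hgy : ∀ n, g (y n) = 0)
    (hlam : ∀ n, y n ∈ V → SolvesLagrange (Q n) g (y n) (lam n)) :
    (fun n => toEuclideanCLM (𝕜 := ℝ) (matS (jacobian g β₀) (Alim β₀)) (lam n) +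
      fderiv ℝ g β₀ (toEuclideanCLM (𝕜 := ℝ) (Alim β₀)⁻¹ (gradient (Q n) β₀)))
      =o[atTop] fun n => gradient (Q n) β₀ := by
  have hAi (v) : toEuclideanCLM (𝕜 := ℝ) (Alim β₀)⁻¹ (toEuclideanCLM (𝕜 := ℝ) (Alim β₀) v) = v := by
    rw [← mul_apply_eq_comp, ← map_mul, nonsing_inv_mul _ hAinv]
    simp
  have hSi (l) : (-toEuclideanCLM (𝕜 := ℝ) (matS (jacobian g β₀) (Alim β₀))⁻¹) (fderiv ℝ g β₀
      (toEuclideanCLM (𝕜 := ℝ) (Alim β₀)⁻¹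
        (ContinuousLinearMap.adjoint (fderiv ℝ g β₀) l))) = l := by
    rw [_root_.neg_apply, ← map_neg, ← toEuclideanCLM_matS _ _ _ hAinv,
      ← mul_apply_eq_comp, ← map_mul, nonsing_inv_mul _ hS]
    simp
  have h3 := ((hg.hasStrictFDerivAt one_ne_zero (x := β₀)).isLittleO).comp_tendsto
    (hy.prodMk_nhds tendsto_const_nhds)
  -- Both `y n` and `β₀` satisfy the restriction, so strict differentiability says `G (y n - β₀) =
  -- o(y n - β₀)`.
  simp only [Function.comp_def, hgy, hgβ₀, sub_zero, zero_sub] at h3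
  refine (isLittleO_comp_sub_of_score hAi hSi
    (isLittleO_gradient_sub hV hβ₀ hQ hA hy tendsto_const_nhds)
    (isLittleO_gradient_sub_adjoint hV hβ₀ hQ hg hy hlam)
    h3.of_neg_left).neg_left.congr_left fun n => ?_
  rw [toEuclideanCLM_matS _ _ _ hAinv]
  abel

theorem isLittleO_statBF_sub_statLM {S W : Matrix (Fin q) (Fin q) ℝ}
    {v : ℕ → EuclideanSpace ℝ (Fin q)}
    (h : (fun n => v n - toEuclideanCLM (𝕜 := ℝ) S (lam n)) =o[atTop] lam) :
    (fun n => statBF n S W (lam n) (v n) - statLM n S W (lam n)) =o[atTop]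
      fun n => (n : ℝ) * ‖lam n‖ ^ 2 := by
  simp only [statBF_sub_statLM, pow_two]
  refine (isBigO_refl _ _).mul_isLittleO ?_
  refine (IsBigO.of_bound 1 (Eventually.of_forall fun n => ?_)).trans_isLittleO
    ((isBigO_refl (fun n => ‖lam n‖) atTop).mul_isLittleO
      (((toEuclideanCLM (𝕜 := ℝ) (S * W⁻¹)).isBigO_comp _ atTop).trans_isLittleO h).norm_norm)
  simpa using norm_inner_le_norm (𝕜 := ℝ) _ _

end Expansion

/-! ### From pathwise expansions to limit laws. -/

theorem IsArgmax.isLocalMax {p : ℕ} {f : EuclideanSpace ℝ (Fin p) → ℝ}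
    {K V : Set (EuclideanSpace ℝ (Fin p))} {b : EuclideanSpace ℝ (Fin p)} (h : IsArgmax f K b)
    (hV : IsOpen V) (hVK : V ⊆ K) (hb : b ∈ V) : IsLocalMax f b := by
  filter_upwards [hV.mem_nhds hb] with z hz using h.2 z (hVK hz)

/-- If the multiplier is asymptotically linear in an asymptotically normal score, then the scaled
multiplier is asymptotically normal. -/
theorem tendstoInDistribution_multiplier {Ω : Type*} [MeasurableSpace Ω] {P : Measure Ω}
    [IsProbabilityMeasure P] {p q : ℕ} {B A : Matrix (Fin p) (Fin p) ℝ} (hB : B.PosSemidef)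
    (hA : Aᵀ = A) {g : EuclideanSpace ℝ (Fin p) → EuclideanSpace ℝ (Fin q)}
    {β₀ : EuclideanSpace ℝ (Fin p)} {s : ℕ → Ω → EuclideanSpace ℝ (Fin p)}
    {lam : ℕ → Ω → EuclideanSpace ℝ (Fin q)} (hlam : ∀ n, AEMeasurable (lam n) P)
    (hs : TendstoInDistribution (fun (n : ℕ) ω => √(n : ℝ) • s n ω) atTop id (fun _ => P)
      (multivariateGaussian 0 B)) (S : Matrix (Fin q) (Fin q) ℝ)
    (h : ∀ᵐ ω ∂P, (fun n => toEuclideanCLM (𝕜 := ℝ) S (lam n ω) +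
      fderiv ℝ g β₀ (toEuclideanCLM (𝕜 := ℝ) A⁻¹ (s n ω))) =o[atTop] fun n => s n ω) :
    TendstoInDistribution (fun (n : ℕ) ω => toEuclideanCLM (𝕜 := ℝ) S (√(n : ℝ) • lam n ω)) atTop
      id (fun _ => P) (multivariateGaussian 0 (matOmega (jacobian g β₀) A B)) := by
  let T : EuclideanSpace ℝ (Fin p) →L[ℝ] EuclideanSpace ℝ (Fin q) :=
    -(fderiv ℝ g β₀ ∘L toEuclideanCLM (𝕜 := ℝ) A⁻¹)
  have hAi : (A⁻¹)ᵀ = A⁻¹ := by rw [transpose_nonsing_inv, hA]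
  have hT (y) : (ContinuousLinearMap.adjoint T y).ofLp = (-(jacobian g β₀ * A⁻¹))ᵀ *ᵥ y.ofLp := by
    have hself : ContinuousLinearMap.adjoint (toEuclideanCLM (𝕜 := ℝ) A⁻¹) =
        toEuclideanCLM (𝕜 := ℝ) A⁻¹ := by
      rw [← ContinuousLinearMap.star_eq_adjoint, ← map_star, star_eq_conjTranspose,
        conjTranspose_eq_transpose_of_trivial, hAi]
    rw [map_neg, ContinuousLinearMap.adjoint_comp, hself, transpose_neg, transpose_mul, hAi,
      neg_mulVec, ← mulVec_mulVec, jacobian_transpose_mulVec]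
    rfl
  have hlaw := map_multivariateGaussian_zero hB T _ hT
  have hW : -(jacobian g β₀ * A⁻¹) * B * (-(jacobian g β₀ * A⁻¹))ᵀ =
      matOmega (jacobian g β₀) A B := by
    rw [transpose_neg, transpose_mul, hAi, matOmega]
    simp [Matrix.mul_assoc]
  rw [hW] at hlaw
  have hlin := hs.continuous_comp T.continuous
  have hmeas (n : ℕ) :
      AEMeasurable (fun ω => toEuclideanCLM (𝕜 := ℝ) S (√(n : ℝ) • lam n ω)) P :=
    (ContinuousLinearMap.measurable _).comp_aemeasurable ((hlam n).const_smul (√(n : ℝ)))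
  refine TendstoInDistribution.of_map_eq (tendstoInDistribution_of_tendstoInMeasure_sub _ _ hlin ?_
    hmeas) aemeasurable_id (by simpa using hlaw)
  refine tendstoInMeasure_zero_of_isLittleO
    (fun n => (hmeas n).sub (hlin.forall_aemeasurable n)) hs ?_
  filter_upwards [h] with ω hω
  refine ((isBigO_refl (fun n : ℕ => √(n : ℝ)) atTop).smul_isLittleO hω).congr_left fun n => ?_
  simp [T]

theorem proposition2
    {Ω : Type*} [MeasurableSpace Ω] (P : Measure Ω) [IsProbabilityMeasure P]
    {p q : ℕ}
    -- compact parameter set, true parameter, and a neighbourhood `V` of it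
    (𝓑 V : Set (EuclideanSpace ℝ (Fin p))) (β₀ : EuclideanSpace ℝ (Fin p))
    (h𝓑 : IsCompact 𝓑) (hV : IsOpen V) (hV𝓑 : V ⊆ 𝓑) (hβ₀ : β₀ ∈ V)
    -- restriction function
    (g : EuclideanSpace ℝ (Fin p) → EuclideanSpace ℝ (Fin q))
    (hg : ContDiff ℝ 1 g)
    (hrank : ∀ β ∈ V, (jacobian g β).rank = q)
    -- random objective functions, with an identified limit criterion
    (Q : ℕ → Ω → EuclideanSpace ℝ (Fin p) → ℝ)
    (Qlim : EuclideanSpace ℝ (Fin p) → ℝ)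
    (hQlim_cont : ContinuousOn Qlim 𝓑)
    (hQlim_max : ∀ β ∈ 𝓑, β ≠ β₀ → Qlim β < Qlim β₀)
    (hQ_unif : ∀ᵐ ω ∂P, TendstoUniformlyOn (fun n β => Q n ω β) Qlim atTop 𝓑)
    (hQ_C2 : ∀ᵐ ω ∂P, ∀ n, ContDiffOn ℝ 2 (Q n ω) V)
    -- Hessians converge almost surely, uniformly near `β₀`, with invertible limit at `β₀`
    (Alim : EuclideanSpace ℝ (Fin p) → Matrix (Fin p) (Fin p) ℝ)
    (hA_unif : ∀ᵐ ω ∂P, TendstoUniformlyOn (fun n β => hessian (Q n ω) β) Alim atTop V)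
    (hA_inv : IsUnit (Alim β₀).det)
    -- the score is asymptotically normal
    (B : Matrix (Fin p) (Fin p) ℝ) (hB : B.PosSemidef)
    (hscore : TendstoInDistribution
      (fun (n : ℕ) ω => √(n : ℝ) • gradient (Q n ω) β₀) atTop id (fun _ => P)
      (multivariateGaussian 0 B))
    (hΩ_inv : IsUnit (matOmega (jacobian g β₀) (Alim β₀) B).det)
    -- unconstrained estimator, constrained estimator, Lagrange multiplier
    (βhat βtil : ℕ → Ω → EuclideanSpace ℝ (Fin p)) (lam : ℕ → Ω → EuclideanSpace ℝ (Fin q))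
    (hβhat_meas : ∀ n, AEMeasurable (βhat n) P)
    (hlam_meas : ∀ n, AEMeasurable (lam n) P)
    (hβhat : ∀ᵐ ω ∂P, ∀ n, IsArgmax (Q n ω) 𝓑 (βhat n ω))
    (hβtil : ∀ᵐ ω ∂P, ∀ n, IsArgmax (Q n ω) {β ∈ 𝓑 | g β = 0} (βtil n ω))
    (hlam : ∀ᵐ ω ∂P, ∀ n, βtil n ω ∈ V → SolvesLagrange (Q n ω) g (βtil n ω) (lam n ω))
    -- the null hypothesis
    (hH₀ : g β₀ = 0) :
    let G := jacobian g β₀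
    let S := matS G (Alim β₀)
    let W := matOmega G (Alim β₀) B
    let BF : ℕ → Ω → ℝ := fun n ω => statBF n S W (lam n ω) (g (βhat n ω))
    let LM : ℕ → Ω → ℝ := fun n ω => statLM n S W (lam n ω)
    (∀ᵐ ω ∂P, (fun n => BF n ω - LM n ω) =o[atTop] fun n => (n : ℝ) * ‖lam n ω‖ ^ 2) ∧
    TendstoInMeasure P (fun n ω => BF n ω - LM n ω) atTop (fun _ => 0) ∧
    TendstoInDistribution BF atTop id (fun _ => P) (chiSq q) ∧
    TendstoInDistribution LM atTop id (fun _ => P) (chiSq q) := by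
  intro G S W BF LM
  have hdet : ∀ᵐ ω ∂P, (∀ n, ContDiffOn ℝ 2 (Q n ω) V) ∧
      TendstoUniformlyOn (fun n β => hessian (Q n ω) β) Alim atTop V ∧
      Tendsto (fun n => βhat n ω) atTop (𝓝 β₀) ∧
      (∀ᶠ n in atTop, IsLocalMax (Q n ω) (βhat n ω)) ∧
      Tendsto (fun n => βtil n ω) atTop (𝓝 β₀) ∧ (∀ n, g (βtil n ω) = 0) ∧
      ∀ n, βtil n ω ∈ V → SolvesLagrange (Q n ω) g (βtil n ω) (lam n ω) := by
    filter_upwards [hQ_unif, hQ_C2, hA_unif, hβhat, hβtil, hlam] with ω h1 h2 h3 h4 h5 h6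
    have hlim : Tendsto (fun n => βhat n ω) atTop (𝓝 β₀) :=
      tendsto_of_isMax_of_tendstoUniformlyOn h𝓑 (hV𝓑 hβ₀) h1 hQlim_cont hQlim_max
        (fun n => (h4 n).1) fun n => (h4 n).2 _ (hV𝓑 hβ₀)
    refine ⟨h2, h3, hlim, ?_, ?_, fun n => (h5 n).1.2, h6⟩
    · filter_upwards [hlim.eventually (hV.mem_nhds hβ₀)] with n hn
      exact (h4 n).isLocalMax hV hV𝓑 hn
    · exact tendsto_of_isMax_of_tendstoUniformlyOn h𝓑 (hV𝓑 hβ₀) h1 hQlim_cont hQlim_max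
        (fun n => (h5 n).1.1) fun n => (h5 n).2 _ ⟨hV𝓑 hβ₀, hH₀⟩
  -- `Alim` is deterministic, so a single path from the almost sure event suffices.
  obtain ⟨hsym, hneg⟩ : (Alim β₀)ᵀ = Alim β₀ ∧ (-Alim β₀).PosSemidef := by
    obtain ⟨ω, h2, h3, hx, hmax, -⟩ := hdet.exists
    exact ⟨limit_hessian_transpose hV hβ₀ h2 h3, posSemidef_neg_limit_hessian hV hβ₀ h2 h3 hx hmax⟩
  have hnegdef : (-Alim β₀).PosDef :=
    hneg.posDef_iff_isUnit.2 ((isUnit_iff_isUnit_det _).2 hA_inv).neg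
  have hS : S.PosDef := posDef_matS hnegdef (hrank β₀ hβ₀)
  have hSsym : Sᵀ = S := by simpa [IsHermitian] using hS.isHermitian
  have hSdet : IsUnit S.det := (isUnit_iff_isUnit_det _).1 hS.isUnit
  have hWpd : W.PosDef := by
    have hAi : ((Alim β₀)⁻¹)ᵀ = (Alim β₀)⁻¹ := by rw [transpose_nonsing_inv, hsym]
    have hpsd : W.PosSemidef := by
      have := hB.mul_mul_conjTranspose_same (G * (Alim β₀)⁻¹)
      rw [conjTranspose_eq_transpose_of_trivial, transpose_mul, hAi] at this
      simpa only [W, matOmega, G, Matrix.mul_assoc] using this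
    exact hpsd.posDef_iff_isUnit.2 ((isUnit_iff_isUnit_det _).2 hΩ_inv)
  have hSlam := tendstoInDistribution_multiplier hB hsym (g := g) (β₀ := β₀) hlam_meas hscore S (by
    filter_upwards [hdet] with ω hω
    obtain ⟨h2, h3, -, -, hy, hgy, h6⟩ := hω
    exact isLittleO_multiplier_add_score hV hβ₀ h2 hg hH₀ h3 hA_inv hSdet hy hgy h6)
  have hdiff : ∀ᵐ ω ∂P, (fun n => BF n ω - LM n ω) =o[atTop] fun n => (n : ℝ) * ‖lam n ω‖ ^ 2 := by
    filter_upwards [hdet] with ω hω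
    obtain ⟨h2, h3, hx, hmax, hy, hgy, h6⟩ := hω
    exact isLittleO_statBF_sub_statLM
      (isLittleO_restriction_sub hV hβ₀ h2 hg h3 hA_inv hx hmax hy hgy h6)
  have hLM : TendstoInDistribution LM atTop id (fun _ => P) (chiSq q) := by
    have hcont : Continuous fun y : EuclideanSpace ℝ (Fin q) => y.ofLp ⬝ᵥ (W⁻¹ *ᵥ y.ofLp) := by
      fun_prop
    have h := hSlam.continuous_comp hcont
    have heq : (fun n : ℕ => (fun y : EuclideanSpace ℝ (Fin q) => y.ofLp ⬝ᵥ (W⁻¹ *ᵥ y.ofLp)) ∘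
        fun ω => toEuclideanCLM (𝕜 := ℝ) S (√(n : ℝ) • lam n ω)) = LM := by
      ext n ω
      exact (statLM_eq n hSsym _).symm
    rw [heq] at h
    refine TendstoInDistribution.of_map_eq h aemeasurable_id ?_
    rw [Measure.map_id]
    exact map_quadratic_multivariateGaussian hWpd
  have hBF_meas (n : ℕ) : AEMeasurable (BF n) P := by
    have hcont : Continuous fun z : EuclideanSpace ℝ (Fin q) × EuclideanSpace ℝ (Fin q) =>
        statBF n S W z.1 z.2 := by
      unfold statBF
      fun_prop
    exact hcont.measurable.comp_aemeasurable
      ((hlam_meas n).prodMk (hg.continuous.measurable.comp_aemeasurable (hβhat_meas n)))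
  have hprob : TendstoInMeasure P (fun n ω => BF n ω - LM n ω) atTop fun _ => 0 := by
    -- n‖λ‖² equals ‖S⁻¹(√n Sλ)‖², a continuous image of a sequence converging in distribution.
    have hnorm := hSlam.continuous_comp
      (((toEuclideanCLM (𝕜 := ℝ) S⁻¹).continuous.norm).pow 2)
    refine tendstoInMeasure_zero_of_isLittleO
      (fun n => (hBF_meas n).sub (hLM.forall_aemeasurable n)) hnorm ?_
    filter_upwards [hdiff] with ω hω
    refine hω.congr_right fun n => ?_
    rw [Function.comp_apply, Pi.pow_apply, ← mul_apply_eq_comp, ← map_mul, nonsing_inv_mul _ hSdet, map_one,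
      one_apply_eq_self, norm_smul, mul_pow, Real.norm_eq_abs, sq_abs,
      Real.sq_sqrt (Nat.cast_nonneg n)]
  exact ⟨hdiff, hprob, tendstoInDistribution_of_tendstoInMeasure_sub BF _ hLM hprob hBF_meas, hLM⟩
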